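/- Let $X_1,\dots,X_n$ be Polish spaces with their Borel $\sigma$-algebras, let $X=X_1\times\dots\times X_n$, and let $\mu_k$ be a Borel probability measure on $X_k$ for $k=1,\dots,n$. Let $C_L(\mu_k)$ be the space of continuous functions $f:X_k\to\mathbb{R}$ with $\int_{X_k}|f|\,d\mu_k<\infty$, and let $C_L(\mu)$ be the space of continuous functions $h:X\to\mathbb{R}$ for which there are $f_k\in C_L(\mu_k)$, $k=1,\dots,n$, such that $|h(x_1,\dots,x_n)|\le\sum_{k=1}^n f_k(x_k)$ for all $(x_1,\dots,x_n)\in X$. Let $W$ be any linear subspace of $C_L(\mu)$, let $c\in C_L(\mu)$, and let $\Pi_W$ be the set of Borel probability measures $\pi$ on $X$ whose marginal on $X_k$ is $\mu_k$ for every $k$ and which satisfy $\int_X\omega\,d\pi=0$ for all $\omega\in W$. Then, as an identity in $[-\infty,+\infty]$, $$ \inf_{\pi\in\Pi_W}\int_X c\,d\pi=\sup\left\{\sum_{k=1}^n\int_{X_k}f_k\,d\mu_k \;:\; f_k\in C_L(\mu_k)\ (1\le k\le n),\ \omega\in W,\ \sum_{k=1}^n f_k(x_k)+\omega(x)\le c(x)\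 \text{for all } x=(x_1,\dots,x_n)\in X\right\}. $$ This includes the case where $\Pi_W$ is empty, with the convention $\inf\varnothing=+\infty$ (so the supremum is then $+\infty$). -/

import Mathlib

open MeasureTheory

noncomputable section

/-- The space `C_L(ν)` of continuous real functions on `Y` that are absolutely integrable with
respect to `ν`. -/
def marginalCL {Y : Type*} [TopologicalSpace Y] [MeasurableSpace Y] (ν : ProbabilityMeasure Y) :
    Submodule ℝ C(Y, ℝ) where
  carrier := {f | Integrable (fun y => f y) (ν : Measure Y)}
  add_mem' := fun hf hg => Integrable.add hf hg
  zero_mem' := integrable_zero _ _ _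
  smul_mem' := fun r _ hf => Integrable.smul r hf

/-- The space `C_L(μ)` of continuous functions `h` on the product `X_1 × ⋯ × X_n` such that
`|h(x)| ≤ f_1(x_1) + ⋯ + f_n(x_n)` for some `f_i ∈ C_L(μ_i)`. -/
def productCL {n : ℕ} {X : Fin n → Type*} [∀ i, TopologicalSpace (X i)]
    [∀ i, MeasurableSpace (X i)] (μ : ∀ i, ProbabilityMeasure (X i)) :
    Submodule ℝ C((∀ i, X i), ℝ) where
  carrier := {h | ∃ f : ∀ i, C(X i, ℝ), (∀ i, f i ∈ marginalCL (μ i)) ∧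
    ∀ x : ∀ i, X i, |h x| ≤ ∑ i, f i (x i)}
  add_mem' := by
    rintro h g ⟨f, hf, hhf⟩ ⟨f', hf', hgf'⟩
    refine ⟨fun i => f i + f' i, fun i => Submodule.add_mem _ (hf i) (hf' i), fun x => ?_⟩
    simp only [ContinuousMap.add_apply, Finset.sum_add_distrib]
    exact (abs_add_le _ _).trans (add_le_add (hhf x) (hgf' x))
  zero_mem' := ⟨fun _ => 0, fun _ => Submodule.zero_mem _, fun x => by simp⟩
  smul_mem' := by
    rintro r h ⟨f, hf, hhf⟩
    refine ⟨fun i => |r| • f i, fun i => Submodule.smul_mem _ _ (hf i), fun x => ?_⟩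
    simp only [ContinuousMap.smul_apply, smul_eq_mul, abs_mul, ← Finset.mul_sum]
    exact mul_le_mul_of_nonneg_left (hhf x) (abs_nonneg r)

/-- The set `Π(μ)` of transport plans: Borel probability measures on the product whose `i`-th
marginal is `μ_i` for every `i`. -/
def transportPlans {n : ℕ} {X : Fin n → Type*} [∀ i, MeasurableSpace (X i)]
    (μ : ∀ i, ProbabilityMeasure (X i)) : Set (ProbabilityMeasure (∀ i, X i)) :=
  {π | ∀ i, (π : Measure (∀ i, X i)).map (fun x => x i) = (μ i : Measure (X i))}

/-- The set `Π_W` of transport plans that vanish on `W`. -/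
def constrainedPlans {n : ℕ} {X : Fin n → Type*} [∀ i, TopologicalSpace (X i)]
    [∀ i, MeasurableSpace (X i)] (μ : ∀ i, ProbabilityMeasure (X i))
    (W : Submodule ℝ C((∀ i, X i), ℝ)) : Set (ProbabilityMeasure (∀ i, X i)) :=
  {π | π ∈ transportPlans μ ∧ ∀ ω ∈ W, ∫ x, ω x ∂(π : Measure (∀ i, X i)) = 0}

/-- Functions in `C_L(μ)` are integrable with respect to every transport plan, so the integrals in
`constrainedPlans` and in the transport cost are genuine when `W` and the cost lie in `C_L(μ)`. -/
theorem integrable_of_mem_productCL {n : ℕ} {X : Fin n → Type*} [∀ i, TopologicalSpace (X i)]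
    [∀ i, PolishSpace (X i)] [∀ i, MeasurableSpace (X i)] [∀ i, BorelSpace (X i)]
    {μ : ∀ i, ProbabilityMeasure (X i)} {π : ProbabilityMeasure (∀ i, X i)}
    (hπ : π ∈ transportPlans μ) {h : C((∀ i, X i), ℝ)} (hh : h ∈ productCL μ) :
    Integrable (fun x => h x) (π : Measure (∀ i, X i)) := by
  obtain ⟨f, hf, hhf⟩ := hh
  have hi : ∀ i, Integrable (fun x : ∀ i, X i => f i (x i)) (π : Measure (∀ i, X i)) := by
    intro i
    have h1 : Integrable (fun y => f i y) ((π : Measure (∀ i, X i)).map (fun x => x i)) := by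
      rw [hπ i]; exact hf i
    exact h1.comp_measurable (measurable_pi_apply i)
  refine (integrable_finsetSum Finset.univ fun i _ => hi i).mono'
    h.continuous.measurable.aestronglyMeasurable ?_
  exact Filter.Eventually.of_forall fun x => by simpa [Real.norm_eq_abs] using hhf x

end

open MeasureTheory
open scoped BoundedContinuousFunction CompactlySupported

/-! Weak duality is integration of the constraint. For the converse, consider condition (H): `∑ f_i
+ ω ≥ 0` with `ω ∈ W` forces `∑ ∫ f_i ≥ 0`. If (H) fails, a violating pair is a direction along
which the dual value is unbounded.

If (H) holds, the M. Riesz extension theorem gives a positive functional on `C_L(μ)` that integrates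
marginal sums correctly and kills `W` (`exists_nonneg_functional`). Tightness of the `μ_i` makes it
tight, hence a measure: it is represented on the Stone–Čech compactification and pulled back to `X`
(`exists_measure_of_tight`, `exists_plan_of_functional`). So (H) implies that `Π_W` is nonempty.

No separate minimax argument is needed: with `s` the dual supremum, (H) persists for `W + ℝ(c - s)`,
and a plan for this larger space has cost exactly `s`. -/

/-! ### Riesz representation of tight functionals on a completely regular space. -/

theorem exists_stoneCech_extension {X : Type*} [TopologicalSpace X] (g : X →ᵇ ℝ) :
    ∃ G : C(StoneCech X, ℝ), ∀ x, G (stoneCechUnit x) = g x := by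
  have hb : ∀ x, g x ∈ Set.Icc (-‖g‖) ‖g‖ := fun x => abs_le.1 (g.norm_coe_le_norm x)
  have hc : Continuous fun x => (⟨g x, hb x⟩ : Set.Icc (-‖g‖) ‖g‖) :=
    g.continuous.subtype_mk _
  refine ⟨⟨Subtype.val ∘ stoneCechExtend hc,
    continuous_subtype_val.comp (continuous_stoneCechExtend hc)⟩, fun x => ?_⟩
  exact congrArg (Subtype.val : Set.Icc (-‖g‖) ‖g‖ → ℝ) (stoneCechExtend_stoneCechUnit hc x)

/-- A left inverse on `⋃ m, K m` of the inclusion into the Stone–Čech compactification can be chosen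
Borel measurable when the `K m` are compact. -/
theorem exists_measurable_leftInverse_stoneCechUnit {X : Type*} [TopologicalSpace X] [T35Space X]
    [MeasurableSpace X] [BorelSpace X] [Nonempty X]
    [MeasurableSpace (StoneCech X)] [BorelSpace (StoneCech X)]
    (K : ℕ → Set X) (hK : ∀ m, IsCompact (K m)) :
    ∃ r : StoneCech X → X, Measurable r ∧ ∀ m, ∀ x ∈ K m, r (stoneCechUnit x) = x := by
  classical
  have hinj : Function.Injective (stoneCechUnit : X → StoneCech X) :=
    injective_stoneCechUnit_of_t35Space
  obtain ⟨x₀⟩ := ‹Nonempty X›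
  set S : Set X := ⋃ m, K m with hS
  let r : StoneCech X → X := fun z =>
    if h : ∃ x ∈ S, stoneCechUnit x = z then h.choose else x₀
  have hr : ∀ x ∈ S, r (stoneCechUnit x) = x := by
    intro x hx
    have h : ∃ y ∈ S, (stoneCechUnit y : StoneCech X) = stoneCechUnit x := ⟨x, hx, rfl⟩
    simp only [r, dif_pos h]
    exact hinj h.choose_spec.2
  have hr' : ∀ z, z ∉ stoneCechUnit '' S → r z = x₀ := fun z hz => dif_neg hz
  -- Such images are countable unions of compact sets, so they are Borel although `X` itself need
  -- not be Borel in its compactification.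
  have himg : ∀ B : Set X, IsClosed B →
      MeasurableSet (stoneCechUnit '' (S ∩ B) : Set (StoneCech X)) := by
    intro B hB
    rw [hS, Set.iUnion_inter, Set.image_iUnion]
    exact MeasurableSet.iUnion fun m =>
      (((hK m).inter_right hB).image continuous_stoneCechUnit).isClosed.measurableSet
  refine ⟨r, ?_, fun m x hx => hr x (Set.mem_iUnion_of_mem m hx)⟩
  refine measurable_of_isClosed fun B hB => ?_
  have hSm : MeasurableSet (stoneCechUnit '' S : Set (StoneCech X)) := by
    simpa using himg _ isClosed_univ
  have h1 : r ⁻¹' B = stoneCechUnit '' (S ∩ B) ∪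
      ((stoneCechUnit '' S)ᶜ ∩ {_z | x₀ ∈ B}) := by
    ext z
    by_cases hz : z ∈ stoneCechUnit '' S
    · obtain ⟨x, hx, rfl⟩ := hz
      simp [hr x hx, hx, hinj.eq_iff]
    · have hz2 : z ∉ stoneCechUnit '' (S ∩ B) :=
        fun h => hz (Set.image_mono Set.inter_subset_left h)
      simp only [Set.mem_preimage, hr' z hz, Set.mem_union, hz2, false_or, Set.mem_inter_iff,
        Set.mem_compl_iff, hz, not_false_eq_true, true_and, Set.mem_ofPred_eq]
  rw [h1]
  exact (himg B hB).union (hSm.compl.inter (MeasurableSet.const _))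

theorem exists_regular_measure_of_nonneg {Y : Type*} [TopologicalSpace Y] [T2Space Y]
    [CompactSpace Y] [MeasurableSpace Y] [BorelSpace Y] (L : C(Y, ℝ) →ₗ[ℝ] ℝ)
    (hL : ∀ g : C(Y, ℝ), (∀ y, 0 ≤ g y) → 0 ≤ L g) :
    ∃ ν : Measure Y, ν.Regular ∧ ∀ g : C(Y, ℝ), ∫ y, g y ∂ν = L g := by
  let Λ : C_c(Y, ℝ) →ₚ[ℝ] ℝ := PositiveLinearMap.mk₀
    { toFun := fun g => L g.toContinuousMap
      map_add' := fun f g => L.map_add f.toContinuousMap g.toContinuousMap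
      map_smul' := fun a g => L.map_smul a g.toContinuousMap }
    (fun g hg => hL _ fun y => hg y)
  refine ⟨RealRMK.rieszMeasure Λ, inferInstance, fun g => ?_⟩
  exact RealRMK.integral_rieszMeasure Λ (CompactlySupportedContinuousMap.continuousMapEquiv g)

/-- Riesz representation of tight positive functionals on bounded continuous functions. -/
theorem exists_measure_of_tight {X : Type*} [TopologicalSpace X] [T35Space X]
    [MeasurableSpace X] [BorelSpace X] [Nonempty X] (L : (X →ᵇ ℝ) →ₗ[ℝ] ℝ)
    (hL : ∀ g : X →ᵇ ℝ, (∀ x, 0 ≤ g x) → 0 ≤ L g)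
    (htight : ∀ ε : ℝ, 0 < ε → ∃ K : Set X, IsCompact K ∧
      ∀ g : X →ᵇ ℝ, (∀ x, 0 ≤ g x) → (∀ x, g x ≤ 1) → (∀ x ∈ K, g x = 0) → L g ≤ ε) :
    ∃ π : Measure X, IsFiniteMeasure π ∧ ∀ g : X →ᵇ ℝ, ∫ x, g x ∂π = L g := by
  let _ : MeasurableSpace (StoneCech X) := borel _
  have : BorelSpace (StoneCech X) := ⟨rfl⟩
  let u : C(X, StoneCech X) := ⟨stoneCechUnit, continuous_stoneCechUnit⟩
  let res : C(StoneCech X, ℝ) →ₗ[ℝ] (X →ᵇ ℝ) :=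
    { toFun := fun g => (BoundedContinuousFunction.mkOfCompact g).compContinuous u
      map_add' := fun f g => rfl
      map_smul' := fun a g => rfl }
  obtain ⟨ν, hreg, hν⟩ := exists_regular_measure_of_nonneg (L ∘ₗ res)
    (fun g hg => hL _ fun x => hg _)
  choose K hKc hK using fun m : ℕ => htight (1 / ((m : ℝ) + 1)) (by positivity)
  obtain ⟨r, hrm, hr⟩ := exists_measurable_leftInverse_stoneCechUnit K hKc
  have hcl : ∀ m, IsClosed (stoneCechUnit '' K m : Set (StoneCech X)) := fun m =>
    ((hKc m).image continuous_stoneCechUnit).isClosed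
  have hsmall : ∀ m : ℕ, ν (stoneCechUnit '' K m)ᶜ ≤ ENNReal.ofReal (1 / ((m : ℝ) + 1)) := by
    intro m
    -- Inner regularity reduces to compact `D` off the image of `K m`; a Urysohn function for the
    -- two, restricted to `X`, is a test function for tightness.
    rw [(hcl m).isOpen_compl.measure_eq_iSup_isCompact]
    refine iSup₂_le fun D hD => iSup_le fun hDc => ?_
    obtain ⟨g, hg0, hg1, hg⟩ := exists_continuous_zero_one_of_isClosed (hcl m) hDc.isClosed
      (Set.disjoint_left.2 fun z hz hzD => hD hzD hz)
    have h1 : ν D ≤ ENNReal.ofReal (∫ y, g y ∂ν) := by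
      rw [ofReal_integral_eq_lintegral_ofReal
        (f := g) ((BoundedContinuousFunction.mkOfCompact g).integrable ν)
        (Filter.Eventually.of_forall fun y => (hg y).1),
        ← lintegral_indicator_one hDc.isClosed.measurableSet]
      refine lintegral_mono fun y => ?_
      by_cases hy : y ∈ D
      · simp [hy, hg1 hy]
      · simp [hy]
    refine h1.trans (ENNReal.ofReal_le_ofReal ?_)
    rw [hν]
    exact hK m _ (fun x => (hg _).1) (fun x => (hg _).2)
      (fun x hx => hg0 (Set.mem_image_of_mem _ hx))
  have hnull : ν (⋃ m, stoneCechUnit '' K m)ᶜ = 0 := by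
    refine le_antisymm (ge_of_tendsto' (x := Filter.atTop)
      (f := fun m : ℕ => ENNReal.ofReal (1 / ((m : ℝ) + 1))) ?_ fun m => ?_) zero_le
    · simpa using ENNReal.tendsto_ofReal tendsto_one_div_add_atTop_nhds_zero_nat
    · exact (measure_mono (Set.compl_subset_compl.2 (Set.subset_iUnion _ m))).trans (hsmall m)
  refine ⟨ν.map r, inferInstance, fun g => ?_⟩
  obtain ⟨G, hG⟩ := exists_stoneCech_extension g
  rw [integral_map hrm.aemeasurable g.continuous.measurable.aestronglyMeasurable]
  have hae : (fun z => g (r z)) =ᵐ[ν] G := by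
    refine (measure_eq_zero_iff_ae_notMem.1 hnull).mono fun z hz => ?_
    obtain ⟨m, x, hx, rfl⟩ := Set.mem_iUnion.1 (not_not.1 hz)
    exact (congrArg g (hr m x hx)).trans (hG x).symm
  rw [integral_congr_ae hae, hν]
  exact congrArg L (BoundedContinuousFunction.ext hG)

/-! ### Extension of the marginal integrals to a positive functional. -/

section Functional

variable {n : ℕ} {X : Fin n → Type*} [∀ i, TopologicalSpace (X i)] [∀ i, MeasurableSpace (X i)]

/-- The function `x ↦ f₁(x₁) + ⋯ + fₙ(xₙ)`, as an element of `C_L(μ)`. -/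
def marginalSum (μ : ∀ i, ProbabilityMeasure (X i)) :
    (∀ i, marginalCL (μ i)) →ₗ[ℝ] productCL μ where
  toFun f := ⟨⟨fun x => ∑ i, (f i : C(X i, ℝ)) (x i), by fun_prop⟩,
    fun i => |(f i : C(X i, ℝ))|, fun i => Integrable.abs (f i).2,
    fun x => by simpa using Finset.abs_sum_le_sum_abs _ _⟩
  map_add' f g := by
    ext x
    simp [Finset.sum_add_distrib]
  map_smul' a f := by
    ext x
    simp [Finset.mul_sum]

theorem marginalSum_apply (μ : ∀ i, ProbabilityMeasure (X i)) (f : ∀ i, marginalCL (μ i))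
    (x : ∀ i, X i) :
    (marginalSum μ f : C((∀ i, X i), ℝ)) x = ∑ i, (f i : C(X i, ℝ)) (x i) := rfl

/-- The functional `(f₁, …, fₙ) ↦ ∫ f₁ dμ₁ + ⋯ + ∫ fₙ dμₙ`. -/
noncomputable def sumIntegral (μ : ∀ i, ProbabilityMeasure (X i)) : (∀ i, marginalCL (μ i)) →ₗ[ℝ] ℝ where
  toFun f := ∑ i, ∫ y, (f i : C(X i, ℝ)) y ∂(μ i : Measure (X i))
  map_add' f g := by
    rw [← Finset.sum_add_distrib]
    exact Finset.sum_congr rfl fun i _ => integral_add (f i).2 (g i).2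
  map_smul' a f := by
    rw [RingHom.id_apply, smul_eq_mul, Finset.mul_sum]
    exact Finset.sum_congr rfl fun i _ => integral_const_mul _ _

theorem sumIntegral_apply (μ : ∀ i, ProbabilityMeasure (X i)) (f : ∀ i, marginalCL (μ i)) :
    sumIntegral μ f = ∑ i, ∫ y, (f i : C(X i, ℝ)) y ∂(μ i : Measure (X i)) := rfl

/-- The pairs `(f, h)` such that `f₁ + ⋯ + fₙ + h + ω ≥ 0` for some `ω ∈ W`. -/
def dominationCone (μ : ∀ i, ProbabilityMeasure (X i)) (W : Submodule ℝ C((∀ i, X i), ℝ)) :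
    PointedCone ℝ ((∀ i, marginalCL (μ i)) × productCL μ) where
  carrier := {p | ∃ ω ∈ W, ∀ x, 0 ≤ (marginalSum μ p.1 : C((∀ i, X i), ℝ)) x +
    (p.2 : C((∀ i, X i), ℝ)) x + ω x}
  add_mem' := by
    rintro p q ⟨ω, hω, hp⟩ ⟨ω', hω', hq⟩
    refine ⟨ω + ω', W.add_mem hω hω', fun x => ?_⟩
    have := add_nonneg (hp x) (hq x)
    simp only [Prod.fst_add, Prod.snd_add, map_add, Submodule.coe_add, ContinuousMap.add_apply]
    linarith
  zero_mem' := ⟨0, W.zero_mem, fun x => by simp⟩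
  smul_mem' := by
    rintro a p ⟨ω, hω, hp⟩
    refine ⟨(a : ℝ) • ω, W.smul_mem _ hω, fun x => ?_⟩
    have h : 0 ≤ (a : ℝ) * _ := mul_nonneg a.2 (hp x)
    rw [mul_add, mul_add] at h
    have h1 : marginalSum μ (a • p).1 = (a : ℝ) • marginalSum μ p.1 :=
      (marginalSum μ).map_smul (a : ℝ) p.1
    have h2 : (a • p).2 = (a : ℝ) • p.2 := rfl
    rw [h1, h2]
    simp only [Submodule.coe_smul, ContinuousMap.smul_apply, smul_eq_mul]
    linarith

/-- The extension takes place on pairs `(f, h)` because a marginal sum does not determine its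
summands, so `sumIntegral` is not visibly well defined on such sums. Compatibility then follows from
positivity, as the cone contains the relevant pairs with both signs. -/
theorem exists_nonneg_functional (μ : ∀ i, ProbabilityMeasure (X i))
    (W : Submodule ℝ C((∀ i, X i), ℝ))
    (H : ∀ f : ∀ i, marginalCL (μ i), ∀ ω ∈ W,
      (∀ x, 0 ≤ (marginalSum μ f : C((∀ i, X i), ℝ)) x + ω x) → 0 ≤ sumIntegral μ f) :
    ∃ L : productCL μ →ₗ[ℝ] ℝ,
      (∀ h : productCL μ, (∀ x, 0 ≤ (h : C((∀ i, X i), ℝ)) x) → 0 ≤ L h) ∧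
      (∀ f, L (marginalSum μ f) = sumIntegral μ f) ∧
      ∀ h : productCL μ, (h : C((∀ i, X i), ℝ)) ∈ W → L h = 0 := by
  let φ : ((∀ i, marginalCL (μ i)) × productCL μ) →ₗ.[ℝ] ℝ :=
    { domain := Submodule.prod ⊤ ⊥
      toFun := sumIntegral μ ∘ₗ LinearMap.fst ℝ _ _ ∘ₗ Submodule.subtype _ }
  obtain ⟨g, hgφ, hg⟩ := riesz_extension (dominationCone μ W) φ
    (by
      rintro ⟨⟨f, h⟩, hp⟩ ⟨ω, hω, hx⟩
      obtain rfl : h = 0 := (Submodule.mem_prod.1 hp).2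
      exact H f ω hω fun x => by simpa using hx x)
    -- Cofinality: a marginal majorant of `|h|` moves any pair into the cone.
    (by
      rintro ⟨f, h⟩
      obtain ⟨f', hf', hh⟩ := h.2
      let F : ∀ i, marginalCL (μ i) := fun i => ⟨f' i, hf' i⟩
      refine ⟨⟨(F - f, 0), Submodule.mem_prod.2 ⟨trivial, rfl⟩⟩, 0, W.zero_mem, fun x => ?_⟩
      simp only [Prod.mk_add_mk, sub_add_cancel, zero_add, ContinuousMap.zero_apply, add_zero]
      have h1 : (marginalSum μ F : C((∀ i, X i), ℝ)) x = ∑ i, f' i (x i) := rfl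
      rw [h1]
      linarith [hh x, neg_abs_le ((h : C((∀ i, X i), ℝ)) x)])
  have hg0 : ∀ f, g (f, 0) = sumIntegral μ f := fun f =>
    hgφ ⟨(f, 0), Submodule.mem_prod.2 ⟨trivial, rfl⟩⟩
  have hsplit : ∀ f h, g (f, h) = sumIntegral μ f + g (0, h) := by
    intro f h
    rw [← hg0, ← map_add]
    simp
  refine ⟨g ∘ₗ LinearMap.inr ℝ _ _, fun h hh => hg _ ⟨0, W.zero_mem, fun x => ?_⟩,
    fun f => ?_, fun h hh => ?_⟩
  · simpa using hh x
  · have h1 := hg (-f, marginalSum μ f) ⟨0, W.zero_mem, fun x => by simp⟩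
    have h2 := hg (f, -marginalSum μ f) ⟨0, W.zero_mem, fun x => by simp⟩
    have h3 : g (0, -marginalSum μ f) = - g (0, marginalSum μ f) := by
      rw [← map_neg g, Prod.neg_mk, neg_zero]
    rw [hsplit, map_neg] at h1
    rw [hsplit, h3] at h2
    change g (0, marginalSum μ f) = _
    linarith
  · have h1 := hg (0, h) ⟨-h, W.neg_mem hh, fun x => by simp⟩
    have h2 := hg (0, -h) ⟨h, hh, fun x => by simp⟩
    have h3 : g (0, -h) = - g (0, h) := by
      rw [← map_neg g, Prod.neg_mk, neg_zero]
    change g (0, h) = 0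
    linarith

end Functional

/-! ### Tightness and representation by a transport plan. -/

/-- An open neighbourhood of a product of compact sets can be separated from it by functions of the
single coordinates. -/
theorem exists_coordinate_functions {ι : Type*} [Fintype ι] {X : ι → Type*}
    [∀ i, TopologicalSpace (X i)] [∀ i, TopologicalSpace.MetrizableSpace (X i)]
    {K : ∀ i, Set (X i)} (hK : ∀ i, IsCompact (K i)) {U : Set (∀ i, X i)} (hU : IsOpen U)
    (hKU : Set.univ.pi K ⊆ U) :
    ∃ φ : ∀ i, C(X i, ℝ), (∀ i, Set.EqOn (φ i) 0 (K i)) ∧ (∀ i y, φ i y ∈ Set.Icc 0 1) ∧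
      ∀ x ∉ U, 1 ≤ ∑ i, φ i (x i) := by
  let _ : ∀ i, MetricSpace (X i) := fun i => TopologicalSpace.metrizableSpaceMetric (X i)
  -- In the sup metric, a point outside this thickening has some coordinate at distance at least `d`
  -- from `K i`, where `φ i = 1`.
  obtain ⟨d, hd, hdU⟩ := (isCompact_univ_pi hK).exists_thickening_subset_open hU hKU
  choose φ hφ0 hφ1 hφ using fun i => exists_continuous_zero_one_of_isClosed (hK i).isClosed
    (Metric.isOpen_thickening (δ := d) (E := K i)).isClosed_compl
    (Set.disjoint_compl_right_iff_subset.2 (Metric.self_subset_thickening hd _))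
  refine ⟨φ, hφ0, hφ, fun x hx => ?_⟩
  by_contra! hlt
  refine hx (hdU ?_)
  have h1 : ∀ i, x i ∈ Metric.thickening d (K i) := by
    intro i
    by_contra hi
    have h2 : φ i (x i) = 1 := hφ1 i hi
    have h3 := Finset.single_le_sum (f := fun i => φ i (x i)) (fun i _ => (hφ i (x i)).1)
      (Finset.mem_univ i)
    simp only [h2] at h3
    linarith
  simp only [Metric.mem_thickening_iff] at h1
  choose z hz hzd using h1
  exact Metric.mem_thickening_iff.2 ⟨z, fun i _ => hz i, (dist_pi_lt_iff hd).2 hzd⟩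

theorem mem_marginalCL_of_bounded {Y : Type*} [TopologicalSpace Y] [MeasurableSpace Y]
    [OpensMeasurableSpace Y] (ν : ProbabilityMeasure Y) (g : C(Y, ℝ)) (C : ℝ)
    (hC : ∀ y, |g y| ≤ C) : g ∈ marginalCL ν :=
  Integrable.of_bound g.continuous.measurable.aestronglyMeasurable C (Filter.Eventually.of_forall hC)

section Representation

variable {n : ℕ} {X : Fin n → Type*} [∀ i, TopologicalSpace (X i)] [∀ i, MeasurableSpace (X i)]

theorem monotone_of_nonneg {μ : ∀ i, ProbabilityMeasure (X i)} {L : productCL μ →ₗ[ℝ] ℝ}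
    (hL : ∀ h : productCL μ, (∀ x, 0 ≤ (h : C((∀ i, X i), ℝ)) x) → 0 ≤ L h)
    {h h' : productCL μ}
    (hh : ∀ x, (h : C((∀ i, X i), ℝ)) x ≤ (h' : C((∀ i, X i), ℝ)) x) : L h ≤ L h' := by
  have := hL (h' - h) fun x => sub_nonneg.2 (hh x)
  rwa [map_sub, sub_nonneg] at this

variable [∀ i, BorelSpace (X i)]

theorem mem_productCL_of_bounded [NeZero n] (μ : ∀ i, ProbabilityMeasure (X i))
    (g : C((∀ i, X i), ℝ)) (C : ℝ) (hC : ∀ x, |g x| ≤ C) : g ∈ productCL μ := by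
  have hC0 : ∀ x : ∀ i, X i, 0 ≤ C := fun x => (abs_nonneg _).trans (hC x)
  refine ⟨fun i => ContinuousMap.const _ C,
    fun i => mem_marginalCL_of_bounded _ _ |C| fun _ => le_rfl, fun x => (hC x).trans ?_⟩
  exact Finset.single_le_sum (f := fun _ : Fin n => C) (fun _ _ => hC0 x) (Finset.mem_univ 0)

/-- Bounded continuous functions as elements of `C_L(μ)`. -/
def boundedToProductCL [NeZero n] (μ : ∀ i, ProbabilityMeasure (X i)) :
    ((∀ i, X i) →ᵇ ℝ) →ₗ[ℝ] productCL μ where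
  toFun g := ⟨g.toContinuousMap, mem_productCL_of_bounded μ _ ‖g‖ g.norm_coe_le_norm⟩
  map_add' _ _ := rfl
  map_smul' _ _ := rfl

theorem integral_marginalSum {μ : ∀ i, ProbabilityMeasure (X i)}
    {π : ProbabilityMeasure (∀ i, X i)} (hπ : π ∈ transportPlans μ)
    (f : ∀ i, marginalCL (μ i)) :
    ∫ x, (marginalSum μ f : C((∀ i, X i), ℝ)) x ∂(π : Measure (∀ i, X i)) =
      sumIntegral μ f := by
  have hm : ∀ i, AEStronglyMeasurable (fun y => (f i : C(X i, ℝ)) y)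
      ((π : Measure (∀ i, X i)).map fun x => x i) := fun i =>
    (f i : C(X i, ℝ)).continuous.measurable.aestronglyMeasurable
  simp only [marginalSum_apply]
  rw [integral_finsetSum, sumIntegral_apply]
  · refine Finset.sum_congr rfl fun i _ => ?_
    rw [← hπ i, integral_map (measurable_pi_apply i).aemeasurable (hm i)]
  · intro i _
    have h1 : Integrable (fun y => (f i : C(X i, ℝ)) y)
        ((π : Measure (∀ i, X i)).map fun x => x i) := by
      rw [hπ i]; exact (f i).2
    exact h1.comp_measurable (measurable_pi_apply i)

variable [∀ i, PolishSpace (X i)]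

/-- A function `g` vanishing on a product of compact sets is below `δ` on a neighbourhood of it, and
off that neighbourhood it is at most `∑ φ_i`. Thus `g` has a majorant that is a marginal sum, whose
`L`-value is known. -/
theorem tight_of_marginals [NeZero n] {μ : ∀ i, ProbabilityMeasure (X i)}
    {L : productCL μ →ₗ[ℝ] ℝ}
    (hL : ∀ h : productCL μ, (∀ x, 0 ≤ (h : C((∀ i, X i), ℝ)) x) → 0 ≤ L h)
    (hLm : ∀ f, L (marginalSum μ f) = sumIntegral μ f) {ε : ℝ} (hε : 0 < ε) :
    ∃ K : Set (∀ i, X i), IsCompact K ∧ ∀ g : (∀ i, X i) →ᵇ ℝ, (∀ x, 0 ≤ g x) →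
      (∀ x, g x ≤ 1) → (∀ x ∈ K, g x = 0) → L (boundedToProductCL μ g) ≤ ε := by
  have hn : (0 : ℝ) < n := Nat.cast_pos.2 (NeZero.pos n)
  -- Each coordinate costs `δ` for `φ i` and `δ` for the added constant.
  set δ : ℝ := ε / (2 * n) with hδ
  have hδ0 : 0 < δ := by positivity
  have hK : ∀ i, ∃ K : Set (X i), IsCompact K ∧ (μ i : Measure (X i)) Kᶜ ≤ ENNReal.ofReal δ := by
    intro i
    let _ := TopologicalSpace.upgradeIsCompletelyMetrizable (X i)
    obtain ⟨K, hK, hKμ⟩ := isTightMeasureSet_iff_exists_isCompact_measure_compl_le.1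
      (isTightMeasureSet_singleton (μ := (μ i : Measure (X i)))) (ENNReal.ofReal δ)
      (ENNReal.ofReal_pos.2 hδ0)
    exact ⟨K, hK, hKμ _ rfl⟩
  choose K hKc hKμ using hK
  refine ⟨Set.univ.pi K, isCompact_univ_pi hKc, fun g _ hg1 hgK => ?_⟩
  obtain ⟨φ, hφ0, hφ, hφU⟩ := exists_coordinate_functions hKc
    (isOpen_lt g.continuous (continuous_const (y := δ)))
    (fun x hx => by simpa [hgK x hx] using hδ0)
  have hφm : ∀ i, φ i ∈ marginalCL (μ i) := fun i =>
    mem_marginalCL_of_bounded _ _ 1 fun y => by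
      rw [abs_of_nonneg (hφ i y).1]; exact (hφ i y).2
  have hcm : ∀ i, ContinuousMap.const (X i) δ ∈ marginalCL (μ i) := fun i =>
    mem_marginalCL_of_bounded _ _ |δ| fun _ => le_rfl
  let F : ∀ i, marginalCL (μ i) := fun i => ⟨φ i, hφm i⟩ + ⟨ContinuousMap.const (X i) δ, hcm i⟩
  have hF : ∀ i y, (F i : C(X i, ℝ)) y = φ i y + δ := fun i y => rfl
  have hint : ∀ i, ∫ y, φ i y ∂(μ i : Measure (X i)) ≤ δ := by
    intro i
    have hm : MeasurableSet (K i)ᶜ := (hKc i).isClosed.measurableSet.compl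
    calc ∫ y, φ i y ∂(μ i : Measure (X i))
        ≤ ∫ y, (K i)ᶜ.indicator 1 y ∂(μ i : Measure (X i)) := by
          refine integral_mono (hφm i) ((integrable_const 1).indicator hm) fun y => ?_
          by_cases hy : y ∈ K i
          · simp [hy, hφ0 i hy]
          · simpa [hy] using (hφ i y).2
      _ = (μ i : Measure (X i)).real (K i)ᶜ := integral_indicator_one hm
      _ ≤ δ := ENNReal.toReal_le_of_le_ofReal hδ0.le (hKμ i)
  calc L (boundedToProductCL μ g) ≤ L (marginalSum μ F) := by
        refine monotone_of_nonneg hL fun x => ?_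
        rw [marginalSum_apply]
        simp only [hF, Finset.sum_add_distrib, Finset.sum_const, Finset.card_univ,
          Fintype.card_fin, nsmul_eq_mul]
        change g x ≤ _
        have hnδ : δ ≤ n * δ :=
          le_mul_of_one_le_left hδ0.le (by exact_mod_cast NeZero.one_le)
        by_cases hx : g x < δ
        · linarith [Finset.sum_nonneg fun i (_ : i ∈ Finset.univ) => (hφ i (x i)).1]
        · linarith [hφU x hx, hg1 x]
    _ = ∑ i, (∫ y, φ i y ∂(μ i : Measure (X i)) + δ) := by
        rw [hLm, sumIntegral_apply]
        refine Finset.sum_congr rfl fun i _ => ?_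
        simp only [hF]
        rw [integral_add (hφm i) (integrable_const _)]
        simp
    _ ≤ ∑ _i : Fin n, (δ + δ) := Finset.sum_le_sum fun i _ => by linarith [hint i]
    _ = ε := by
        simp only [Finset.sum_const, Finset.card_univ, Fintype.card_fin, nsmul_eq_mul, hδ]
        field_simp
        norm_num

/-- Tightness represents `L` only on bounded functions. Truncation gives `∫ h ≤ L h` for `h ≥ 0`;
applied to `F + h` and `F - h`, with `F` a marginal majorant of `|h|` on which equality is known, it
gives equality for all `h`. -/
theorem exists_plan_of_functional [NeZero n] {μ : ∀ i, ProbabilityMeasure (X i)}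
    {L : productCL μ →ₗ[ℝ] ℝ}
    (hL : ∀ h : productCL μ, (∀ x, 0 ≤ (h : C((∀ i, X i), ℝ)) x) → 0 ≤ L h)
    (hLm : ∀ f, L (marginalSum μ f) = sumIntegral μ f) :
    ∃ π ∈ transportPlans μ, ∀ h : productCL μ,
      ∫ x, (h : C((∀ i, X i), ℝ)) x ∂(π : Measure (∀ i, X i)) = L h := by
  have : ∀ i, Nonempty (X i) := fun i => (μ i).nonempty
  obtain ⟨π, hπf, hπ⟩ := exists_measure_of_tight (L ∘ₗ boundedToProductCL μ)
    (fun g hg => hL _ hg) (fun ε hε => tight_of_marginals hL hLm hε)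
  have hmarg : ∀ i, π.map (fun x => x i) = (μ i : Measure (X i)) := by
    intro i
    have : IsFiniteMeasure (π.map fun x => x i) := inferInstance
    refine ext_of_forall_integral_eq_of_IsFiniteMeasure fun f => ?_
    rw [integral_map (measurable_pi_apply i).aemeasurable
      f.continuous.measurable.aestronglyMeasurable]
    have hf : f.toContinuousMap ∈ marginalCL (μ i) :=
      mem_marginalCL_of_bounded _ _ ‖f‖ f.norm_coe_le_norm
    -- A function of one coordinate is a marginal sum with a single nonzero term.
    let F : ∀ j, marginalCL (μ j) := Pi.single i ⟨f.toContinuousMap, hf⟩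
    have hFj : ∀ j, j ≠ i → F j = 0 := fun j hj => Pi.single_eq_of_ne hj _
    have hFi : F i = ⟨f.toContinuousMap, hf⟩ := Pi.single_eq_same _ _
    have h1 := hπ (f.compContinuous ⟨fun x => x i, continuous_apply i⟩)
    have h2 : boundedToProductCL μ (f.compContinuous ⟨fun x => x i, continuous_apply i⟩) =
        marginalSum μ F := by
      ext x
      rw [marginalSum_apply, Finset.sum_eq_single i (fun j _ hj => by simp [hFj j hj]) (by simp),
        hFi]
      rfl
    rw [LinearMap.comp_apply, h2, hLm, sumIntegral_apply,
      Finset.sum_eq_single i (fun j _ hj => by simp [hFj j hj]) (by simp), hFi] at h1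
    exact h1
  have hprob : IsProbabilityMeasure π := by
    constructor
    have h := congrArg (fun m : Measure (X 0) => m Set.univ) (hmarg 0)
    simpa [Measure.map_apply (measurable_pi_apply (0 : Fin n)) MeasurableSet.univ] using h
  have hplan : (⟨π, hprob⟩ : ProbabilityMeasure (∀ i, X i)) ∈ transportPlans μ := hmarg
  have hle : ∀ h : productCL μ, (∀ x, 0 ≤ (h : C((∀ i, X i), ℝ)) x) →
      ∫ x, (h : C((∀ i, X i), ℝ)) x ∂π ≤ L h := by
    intro h hh
    have hhi : Integrable (fun x => (h : C((∀ i, X i), ℝ)) x) π :=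
      integrable_of_mem_productCL hplan h.2
    have hbound : ∀ (N : ℕ) x, |min ((h : C((∀ i, X i), ℝ)) x) (N : ℝ)| ≤ N := fun N x => by
      rw [abs_of_nonneg (le_min (hh x) N.cast_nonneg)]; exact min_le_right _ _
    let T : ℕ → (∀ i, X i) →ᵇ ℝ := fun N => BoundedContinuousFunction.ofNormedAddCommGroup
      (fun x => min ((h : C((∀ i, X i), ℝ)) x) (N : ℝ)) (by fun_prop) N (hbound N)
    have hlim : Filter.Tendsto (fun N => ∫ x, T N x ∂π) Filter.atTop
        (nhds (∫ x, (h : C((∀ i, X i), ℝ)) x ∂π)) := by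
      refine tendsto_integral_of_dominated_convergence (fun x => (h : C((∀ i, X i), ℝ)) x)
        (fun N => (T N).continuous.measurable.aestronglyMeasurable) hhi
        (fun N => Filter.Eventually.of_forall fun x => ?_)
        (Filter.Eventually.of_forall fun x => ?_)
      · change |min ((h : C((∀ i, X i), ℝ)) x) (N : ℝ)| ≤ _
        rw [abs_of_nonneg (le_min (hh x) N.cast_nonneg)]
        exact min_le_left _ _
      · obtain ⟨M, hM⟩ := exists_nat_ge ((h : C((∀ i, X i), ℝ)) x)
        refine tendsto_const_nhds.congr' (Filter.eventually_atTop.2 ⟨M, fun N hN => ?_⟩)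
        exact (min_eq_left (hM.trans (Nat.cast_le.2 hN))).symm
    refine le_of_tendsto' hlim fun N => ?_
    rw [hπ]
    exact monotone_of_nonneg hL fun x => min_le_left _ _
  refine ⟨⟨π, hprob⟩, hplan, fun h => ?_⟩
  obtain ⟨f, hf, hfh⟩ := h.2
  let F : ∀ i, marginalCL (μ i) := fun i => ⟨f i, hf i⟩
  have hF : ∀ x, |(h : C((∀ i, X i), ℝ)) x| ≤ (marginalSum μ F : C((∀ i, X i), ℝ)) x := hfh
  have h0 : ∫ x, (marginalSum μ F : C((∀ i, X i), ℝ)) x ∂π = sumIntegral μ F :=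
    integral_marginalSum hplan F
  have hhi : Integrable (fun x => (h : C((∀ i, X i), ℝ)) x) π :=
    integrable_of_mem_productCL hplan h.2
  have hFi : Integrable (fun x => (marginalSum μ F : C((∀ i, X i), ℝ)) x) π :=
    integrable_of_mem_productCL hplan (marginalSum μ F).2
  have h1 := hle (marginalSum μ F + h) fun x => by
    have := (abs_le.1 (hF x)).1
    simp only [Submodule.coe_add, ContinuousMap.add_apply]
    linarith
  have h2 := hle (marginalSum μ F - h) fun x => sub_nonneg.2 (abs_le.1 (hF x)).2
  simp only [Submodule.coe_add, Submodule.coe_sub, ContinuousMap.add_apply,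
    ContinuousMap.sub_apply, map_add, map_sub, hLm] at h1 h2
  rw [integral_add hFi hhi] at h1
  rw [integral_sub hFi hhi] at h2
  change ∫ x, (h : C((∀ i, X i), ℝ)) x ∂π = L h
  linarith

theorem exists_mem_constrainedPlans [NeZero n] (μ : ∀ i, ProbabilityMeasure (X i))
    (W : Submodule ℝ C((∀ i, X i), ℝ)) (hW : W ≤ productCL μ)
    (H : ∀ f : ∀ i, marginalCL (μ i), ∀ ω ∈ W,
      (∀ x, 0 ≤ (marginalSum μ f : C((∀ i, X i), ℝ)) x + ω x) → 0 ≤ sumIntegral μ f) :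
    ∃ π, π ∈ constrainedPlans μ W := by
  obtain ⟨L, hL, hLm, hLW⟩ := exists_nonneg_functional μ W H
  obtain ⟨π, hπ, hπL⟩ := exists_plan_of_functional hL hLm
  exact ⟨π, hπ, fun ω hω => (hπL ⟨ω, hW hω⟩).trans (hLW ⟨ω, hW hω⟩ hω)⟩

end Representation

/-! ### Weak duality, attainment, and the duality theorem. -/

section Duality

variable {n : ℕ} {X : Fin n → Type*} [∀ i, TopologicalSpace (X i)]
    [∀ i, PolishSpace (X i)] [∀ i, MeasurableSpace (X i)] [∀ i, BorelSpace (X i)]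

theorem sumIntegral_le_integral {μ : ∀ i, ProbabilityMeasure (X i)}
    {W : Submodule ℝ C((∀ i, X i), ℝ)} (hW : W ≤ productCL μ)
    {c : C((∀ i, X i), ℝ)} (hc : c ∈ productCL μ) {π : ProbabilityMeasure (∀ i, X i)}
    (hπ : π ∈ constrainedPlans μ W) (f : ∀ i, marginalCL (μ i))
    {ω : C((∀ i, X i), ℝ)} (hω : ω ∈ W)
    (h : ∀ x, (marginalSum μ f : C((∀ i, X i), ℝ)) x + ω x ≤ c x) :
    sumIntegral μ f ≤ ∫ x, c x ∂(π : Measure (∀ i, X i)) := by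
  have hf := integrable_of_mem_productCL hπ.1 (marginalSum μ f).2
  have hωi := integrable_of_mem_productCL hπ.1 (hW hω)
  have := integral_mono (hf.add hωi) (integrable_of_mem_productCL hπ.1 hc) h
  rw [integral_add' hf hωi, integral_marginalSum hπ.1, hπ.2 ω hω, add_zero] at this
  exact this

/-- If the dual values are bounded, then their supremum is the cost of some constrained plan. -/
theorem exists_plan_integral_eq_sSup [NeZero n] (μ : ∀ i, ProbabilityMeasure (X i))
    (W : Submodule ℝ C((∀ i, X i), ℝ)) (hW : W ≤ productCL μ)
    (c : C((∀ i, X i), ℝ)) (hc : c ∈ productCL μ)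
    (H : ∀ f : ∀ i, marginalCL (μ i), ∀ ω ∈ W,
      (∀ x, 0 ≤ (marginalSum μ f : C((∀ i, X i), ℝ)) x + ω x) → 0 ≤ sumIntegral μ f) :
    ∃ s : ℝ, IsLUB {a | ∃ f : ∀ i, marginalCL (μ i), ∃ ω ∈ W,
        (∀ x, (marginalSum μ f : C((∀ i, X i), ℝ)) x + ω x ≤ c x) ∧ sumIntegral μ f = a} s ∧
      ∃ π ∈ constrainedPlans μ W, ∫ x, c x ∂(π : Measure (∀ i, X i)) = s := by
  set A : Set ℝ := {a | ∃ f : ∀ i, marginalCL (μ i), ∃ ω ∈ W,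
    (∀ x, (marginalSum μ f : C((∀ i, X i), ℝ)) x + ω x ≤ c x) ∧ sumIntegral μ f = a} with hA
  obtain ⟨f', hf', hcf'⟩ := id hc
  let F : ∀ i, marginalCL (μ i) := fun i => ⟨f' i, hf' i⟩
  have hF : ∀ x, |c x| ≤ (marginalSum μ F : C((∀ i, X i), ℝ)) x := hcf'
  have hne : A.Nonempty := ⟨_, -F, 0, W.zero_mem, fun x => by
    simpa using neg_le.1 ((neg_le_abs _).trans (hF x)), rfl⟩
  -- every integral of a majorant of `c` modulo `W` is an upper bound
  have hub : ∀ g : ∀ i, marginalCL (μ i), ∀ η ∈ W,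
      (∀ x, c x ≤ (marginalSum μ g : C((∀ i, X i), ℝ)) x + η x) →
      sumIntegral μ g ∈ upperBounds A := by
    rintro g η hη hg _ ⟨f, ω, hω, hf, rfl⟩
    have := H (g - f) (η - ω) (W.sub_mem hη hω) fun x => by
      simp only [map_sub, Submodule.coe_sub, ContinuousMap.sub_apply]
      linarith [hf x, hg x]
    rwa [map_sub, sub_nonneg] at this
  have hbdd : BddAbove A := ⟨_, hub F 0 W.zero_mem fun x => by
    simpa using (le_abs_self _).trans (hF x)⟩
  have hs : IsLUB A (sSup A) := isLUB_csSup hne hbdd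
  set s := sSup A
  refine ⟨s, hs, ?_⟩
  -- A plan that also annihilates `c - s` has cost `s`.
  let k : C((∀ i, X i), ℝ) := c - ContinuousMap.const _ s
  have hk : k ∈ productCL μ := Submodule.sub_mem _ hc
    (mem_productCL_of_bounded μ _ |s| fun _ => le_rfl)
  obtain ⟨π, hπ⟩ := exists_mem_constrainedPlans μ (W ⊔ Submodule.span ℝ {k})
    (sup_le hW ((Submodule.span_singleton_le_iff_mem _ _).2 hk)) (by
      intro f w hw hf
      obtain ⟨ω, hω, y, hy, rfl⟩ := Submodule.mem_sup.1 hw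
      obtain ⟨t, rfl⟩ := Submodule.mem_span_singleton.1 hy
      have hfx : ∀ x, 0 ≤ (marginalSum μ f : C((∀ i, X i), ℝ)) x + (ω x + t * (c x - s)) := hf
      let u : ∀ i, marginalCL (μ i) := Pi.single 0 ⟨ContinuousMap.const _ s,
        mem_marginalCL_of_bounded _ _ |s| fun _ => le_rfl⟩
      have hu0 : u 0 = ⟨ContinuousMap.const _ s,
        mem_marginalCL_of_bounded _ _ |s| fun _ => le_rfl⟩ := Pi.single_eq_same _ _
      have huj : ∀ j, j ≠ 0 → u j = 0 := fun j hj => Pi.single_eq_of_ne hj _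
      have hu : ∀ x, (marginalSum μ u : C((∀ i, X i), ℝ)) x = s := fun x => by
        rw [marginalSum_apply, Finset.sum_eq_single 0 (fun j _ hj => by simp [huj j hj]) (by simp),
          hu0]
        rfl
      have hui : sumIntegral μ u = s := by
        rw [sumIntegral_apply, Finset.sum_eq_single 0 (fun j _ hj => by simp [huj j hj]) (by simp),
          hu0]
        simp
      -- Divide `f + ω + t(c - s) ≥ 0` by `|t|`: for `t < 0`, `s - f/t` majorizes `c` modulo `W`, so
      -- its integral is at least `s`; for `t > 0` it is dual feasible, so its integral is at most
      -- `s`. Either way `∑ ∫ f_i ≥ 0`.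
      rcases lt_trichotomy t 0 with ht | rfl | ht
      · have h1 : s ≤ sumIntegral μ (u - t⁻¹ • f) := by
          refine hs.2 (hub _ (-t⁻¹ • ω) (W.smul_mem _ hω) fun x => ?_)
          have h2 := mul_nonneg (inv_nonneg.2 (neg_nonneg.2 ht.le)) (hfx x)
          have h3 : t⁻¹ * t = 1 := inv_mul_cancel₀ ht.ne
          simp only [map_sub, map_smul, Submodule.coe_sub, Submodule.coe_smul,
            ContinuousMap.sub_apply, ContinuousMap.smul_apply, smul_eq_mul, hu]
          rw [inv_neg] at h2
          linear_combination h2 - (c x - s) * h3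
        rw [map_sub, map_smul, hui, smul_eq_mul] at h1
        exact nonneg_of_mul_nonpos_right (by linarith) (inv_lt_zero.2 ht)
      · exact H f ω hω fun x => by simpa using hfx x
      · have h1 : sumIntegral μ (u - t⁻¹ • f) ≤ s := by
          refine hs.1 ⟨_, -t⁻¹ • ω, W.smul_mem _ hω, fun x => ?_, rfl⟩
          have h2 := mul_nonneg (inv_nonneg.2 ht.le) (hfx x)
          have h3 : t⁻¹ * t = 1 := inv_mul_cancel₀ ht.ne'
          simp only [map_sub, map_smul, Submodule.coe_sub, Submodule.coe_smul,
            ContinuousMap.sub_apply, ContinuousMap.smul_apply, smul_eq_mul, hu]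
          linear_combination h2 + (c x - s) * h3
        rw [map_sub, map_smul, hui, smul_eq_mul] at h1
        exact nonneg_of_mul_nonneg_right (by linarith) (inv_pos.2 ht))
  refine ⟨π, ⟨hπ.1, fun ω hω => hπ.2 ω (Submodule.mem_sup_left hω)⟩, ?_⟩
  have h1 := hπ.2 k (Submodule.mem_sup_right (Submodule.mem_span_singleton_self k))
  have h2 : ∫ x, k x ∂(π : Measure (∀ i, X i)) = ∫ x, c x ∂(π : Measure (∀ i, X i)) - s :=
    (integral_sub (integrable_of_mem_productCL hπ.1 hc) (integrable_const s)).trans (by simp)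
  linarith

end Duality

/-- For `n = 0` nonzero constants are not in `C_L(μ)`, since the empty sum bounds every member by
`0`; hence the separate treatment. -/
theorem constrainedPlans_nonempty_of_fin_zero {X : Fin 0 → Type*} [∀ i, TopologicalSpace (X i)]
    [∀ i, MeasurableSpace (X i)] (μ : ∀ i, ProbabilityMeasure (X i))
    (W : Submodule ℝ C((∀ i, X i), ℝ)) (hW : W ≤ productCL μ) :
    ∃ π, π ∈ constrainedPlans μ W := by
  refine ⟨⟨Measure.dirac isEmptyElim, inferInstance⟩, fun i => i.elim0, fun ω hω => ?_⟩
  obtain ⟨f, -, hf⟩ := hW hω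
  have h0 : ∀ x, ω x = 0 := fun x => by simpa using hf x
  simp [h0]

/-- Kantorovich duality with linear constraints. The identity is between extended reals; in
particular the infimum over an empty set of plans is `⊤`. -/
theorem mainTheorem1 {n : ℕ} {X : Fin n → Type*} [∀ i, TopologicalSpace (X i)]
    [∀ i, PolishSpace (X i)] [∀ i, MeasurableSpace (X i)] [∀ i, BorelSpace (X i)]
    (μ : ∀ i, ProbabilityMeasure (X i))
    (W : Submodule ℝ C((∀ i, X i), ℝ)) (hW : W ≤ productCL μ)
    (c : C((∀ i, X i), ℝ)) (hc : c ∈ productCL μ) :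
    (⨅ π ∈ constrainedPlans μ W,
        ((∫ x, c x ∂(π : Measure (∀ i, X i)) : ℝ) : EReal)) =
      ⨆ (f : ∀ i, C(X i, ℝ)) (_ : ∀ i, f i ∈ marginalCL (μ i))
        (ω : C((∀ i, X i), ℝ)) (_ : ω ∈ W)
        (_ : ∀ x : ∀ i, X i, (∑ i, f i (x i)) + ω x ≤ c x),
        ((∑ i, ∫ y, f i y ∂(μ i : Measure (X i)) : ℝ) : EReal) := by
  refine le_antisymm ?_ ?_
  swap
  · refine le_iInf₂ fun π hπ => iSup₂_le fun f hf => iSup₂_le fun ω hω => iSup_le fun h => ?_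
    exact EReal.coe_le_coe_iff.2
      (sumIntegral_le_integral hW hc hπ (fun i => ⟨f i, hf i⟩) hω h)
  set R : EReal := ⨆ (f : ∀ i, C(X i, ℝ)) (_ : ∀ i, f i ∈ marginalCL (μ i))
        (ω : C((∀ i, X i), ℝ)) (_ : ω ∈ W)
        (_ : ∀ x : ∀ i, X i, (∑ i, f i (x i)) + ω x ≤ c x),
        ((∑ i, ∫ y, f i y ∂(μ i : Measure (X i)) : ℝ) : EReal) with hR
  have hle : ∀ f : ∀ i, marginalCL (μ i), ∀ ω ∈ W,
      (∀ x, (marginalSum μ f : C((∀ i, X i), ℝ)) x + ω x ≤ c x) →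
      ((sumIntegral μ f : ℝ) : EReal) ≤ R := fun f ω hω h =>
    le_iSup₂_of_le (fun i => (f i : C(X i, ℝ))) (fun i => (f i).2)
      (le_iSup₂_of_le ω hω (le_iSup_of_le h le_rfl))
  obtain ⟨f', hf', hcf'⟩ := id hc
  let F : ∀ i, marginalCL (μ i) := fun i => ⟨f' i, hf' i⟩
  have hF : ∀ x, |c x| ≤ (marginalSum μ F : C((∀ i, X i), ℝ)) x := hcf'
  rcases Nat.eq_zero_or_pos n with rfl | hn
  · obtain ⟨π, hπ⟩ := constrainedPlans_nonempty_of_fin_zero μ W hW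
    have hc0 : ∀ x, c x = 0 := fun x => by simpa using hcf' x
    refine (iInf₂_le π hπ).trans (le_trans ?_ (hle 0 0 W.zero_mem fun x => by simp [hc0]))
    simp [hc0]
  have : NeZero n := ⟨hn.ne'⟩
  by_cases H : ∀ f : ∀ i, marginalCL (μ i), ∀ ω ∈ W,
      (∀ x, 0 ≤ (marginalSum μ f : C((∀ i, X i), ℝ)) x + ω x) → 0 ≤ sumIntegral μ f
  · obtain ⟨s, hs, π, hπ, hπs⟩ := exists_plan_integral_eq_sSup μ W hW c hc H
    refine (iInf₂_le π hπ).trans ?_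
    rw [hπs]
    refine EReal.le_of_forall_lt_iff_le.1 fun z hz => EReal.coe_le_coe_iff.2 (hs.2 ?_)
    rintro _ ⟨f, ω, hω, hf, rfl⟩
    exact EReal.coe_le_coe_iff.1 ((hle f ω hω hf).trans hz.le)
  · push Not at H
    obtain ⟨f, ω, hω, hf, hneg⟩ := H
    suffices hT : R = ⊤ by rw [hT]; exact le_top
    refine EReal.eq_top_iff_forall_lt R |>.2 fun y => ?_
    -- `-F ≤ c` is feasible, and subtracting `m (f + ω) ≥ 0` keeps it so while raising the value by
    -- `-m ∑ ∫ f_i`, which is unbounded in `m`.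
    obtain ⟨m, hm⟩ := exists_nat_gt ((y + sumIntegral μ F) / (-sumIntegral μ f))
    rw [div_lt_iff₀ (by linarith)] at hm
    refine lt_of_lt_of_le (EReal.coe_lt_coe_iff.2 ?_)
      (hle (-F - (m : ℝ) • f) (-(m : ℝ) • ω) (W.smul_mem _ hω) fun x => ?_)
    · simp only [map_sub, map_neg, map_smul, smul_eq_mul]
      linarith
    · have h1 := mul_nonneg (Nat.cast_nonneg (α := ℝ) m) (hf x)
      have h2 := (neg_le_abs _).trans (hF x)
      simp only [map_sub, map_neg, map_smul, Submodule.coe_sub, Submodule.coe_neg,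
        Submodule.coe_smul, ContinuousMap.sub_apply, ContinuousMap.neg_apply,
        ContinuousMap.smul_apply, smul_eq_mul]
      linarith
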